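/- Let $(V,\omega)$ be a finite-dimensional real symplectic vector space ($\omega$ a nondegenerate antisymmetric bilinear form) and let $\Lambda$ be its Lagrangian Grassmannian, i.e. the set of the subspaces of $V$ of dimension $\tfrac12\dim V$ on which $\omega$ vanishes. Two Lagrangians are transverse if their intersection is $\{0\}$. For transverse $A,B\in\Lambda$ and for $L\in\Lambda$ transverse to $B$, let $\varphi_{A,B}(L)$ be the symmetric bilinear form $\omega(T\cdot,\cdot)|_{A\times A}$ on $A$, where $T:A\to B$ is the unique linear map such that $L=\{x+Tx: x\in A\}$; the maps $\varphi_{A,B}$ are the charts of an atlas that defines the topology of $\Lambda$. For a symmetric bilinear form $B$ let $\mathrm{sign}(B)=\mathrm n_-(B)-\mathrm n_+(B)$, where $\mathrm n_-(B)$ and $\mathrm n_+(B)$ are the maximal dimensions of a subspace on which $B$ is negative, respectively positive, definite. For $A\in\Lambda$ let the $A$-Maslov index $\mu_A$ be the unique $\tfrac12\mathbb Z$-valued homomorphism on the fundamental groupoid of $\Lambda$ such that \[\mu_A([\gamma])=\tfrac12\,\mathrm{sign}\big(\varphi_{A,B}(\gamma(1))\big)-\tfrac12\,\mathrm{sign}\big(\varphi_{A,B}(\gamma(0))\big)\]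 for every $B\in\Lambda$ transverse to $A$ and every continuous curve $\gamma:[0,1]\to\Lambda$ all of whose values are transverse to $B$. For $A,B,A',B'\in\Lambda$ let the Hörmander index $\mathfrak q(A,B;A',B')$ be the number $\mu_B([\gamma])-\mu_A([\gamma])$, where $\gamma$ is any continuous curve in $\Lambda$ from $A'$ to $B'$ (the number does not depend on $\gamma$). **Proposition.** Let $L,L',L_0,L_1\in\Lambda$ be four Lagrangians with $L$, $L'$ and $L_1$ transverse to $L_0$. Then \[\mathfrak q(L_0,L;L_0,L')=\tfrac12\,\mathrm{sign}\big(\varphi_{L_1,L_0}(L')-\varphi_{L_1,L_0}(L)\big).\] -/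

import Mathlib

open Module

/-- A symplectic form: a nondegenerate antisymmetric bilinear form on a real vector space. -/
structure SymplecticForm (V : Type*) [AddCommGroup V] [Module ℝ V] where
  form : LinearMap.BilinForm ℝ V
  antisymm : ∀ v w, form v w = -form w v
  nondegenerate : form.Nondegenerate

/-- The set of symmetric bilinear forms on a real vector space `E`. -/
def BSym (E : Type*) [AddCommGroup E] [Module ℝ E] : Type _ :=
  {B : LinearMap.BilinForm ℝ E // B.IsSymm}

/-- The difference of two symmetric bilinear forms. -/
instance BSym.instSub (E : Type*) [AddCommGroup E] [Module ℝ E] : Sub (BSym E) :=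
  ⟨fun A B => ⟨A.1 - B.1, A.2.sub B.2⟩⟩

/-- The topology of pointwise convergence on `BSym E`; for finite-dimensional `E`, the only case
used below, this is the canonical (norm) topology of this finite-dimensional vector space. -/
instance BSym.instTopologicalSpace (E : Type*) [AddCommGroup E] [Module ℝ E] :
    TopologicalSpace (BSym E) :=
  TopologicalSpace.induced (fun B (p : E × E) => B.1 p.1 p.2)
    Pi.topologicalSpace

/-- The index `n₋(B)`: the maximal dimension of a subspace on which `B` is negative definite. -/
noncomputable def BSym.index {E : Type*} [AddCommGroup E] [Module ℝ E] (B : BSym E) : ℕ :=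
  sigNeg (LinearMap.BilinMap.toQuadraticMap B.1)

/-- The coindex `n₊(B)`: the maximal dimension of a subspace on which `B` is positive definite. -/
noncomputable def BSym.coindex {E : Type*} [AddCommGroup E] [Module ℝ E] (B : BSym E) : ℕ :=
  sigPos (LinearMap.BilinMap.toQuadraticMap B.1)

/-- The signature, with the sign convention `sign(B) = n₋(B) - n₊(B)`. -/
noncomputable def BSym.sign {E : Type*} [AddCommGroup E] [Module ℝ E] (B : BSym E) : ℤ :=
  (BSym.index B : ℤ) - (BSym.coindex B : ℤ)

/-- The Lagrangian Grassmannian `Λ(V, ω)`: the subspaces of dimension `½ dim V` on which `ω`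
vanishes. -/
def LagrangianGrassmannian {V : Type*} [AddCommGroup V] [Module ℝ V] (ω : SymplecticForm V) :
    Type _ :=
  {L : Submodule ℝ V // 2 * finrank ℝ L = finrank ℝ V ∧ ∀ v ∈ L, ∀ w ∈ L, ω.form v w = 0}

namespace LagrangianGrassmannian

/-- The underlying subspace of a Lagrangian. -/
def space {V : Type*} [AddCommGroup V] [Module ℝ V] {ω : SymplecticForm V}
    (L : LagrangianGrassmannian ω) : Submodule ℝ V := L.1

/-- Two Lagrangians are transverse if they meet only in `0`. -/
def Transverse {V : Type*} [AddCommGroup V] [Module ℝ V] {ω : SymplecticForm V}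
    (L L' : LagrangianGrassmannian ω) : Prop := Disjoint L.space L'.space

/-- `L` is the graph `{x + T x : x ∈ L₀}` of the linear map `T : L₀ → L₁`. -/
def IsGraphOf {V : Type*} [AddCommGroup V] [Module ℝ V] {ω : SymplecticForm V}
    (L L₀ L₁ : LagrangianGrassmannian ω) (T : L₀.space →ₗ[ℝ] L₁.space) : Prop :=
  ∀ v : V, v ∈ L.space ↔ ∃ x : L₀.space, v = (x : V) + (T x : V)

theorem Transverse.isCompl {V : Type*} [AddCommGroup V] [Module ℝ V] [FiniteDimensional ℝ V]
    {ω : SymplecticForm V} {L L' : LagrangianGrassmannian ω} (h : L.Transverse L') :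
    IsCompl L.space L'.space := by
  refine (Submodule.isCompl_iff_disjoint _ _ ?_).2 h
  have h1 : 2 * finrank ℝ L.space = finrank ℝ V := L.2.1
  have h2 : 2 * finrank ℝ L'.space = finrank ℝ V := L'.2.1
  omega

/-- A Lagrangian transverse to `L₁` is the graph of a unique linear map `L₀ → L₁`. -/
theorem existsUnique_isGraphOf {V : Type*} [AddCommGroup V] [Module ℝ V] [FiniteDimensional ℝ V]
    {ω : SymplecticForm V} {L₀ L₁ L : LagrangianGrassmannian ω}
    (h₀₁ : L₀.Transverse L₁) (h : L.Transverse L₁) :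
    ∃! T : L₀.space →ₗ[ℝ] L₁.space, L.IsGraphOf L₀ L₁ T := by
  have hc := h.isCompl
  have key : ∀ v : V, v - (L₁.space.projectionOnto L.space hc.symm v : V) ∈ L.space := by
    intro v
    rw [← Submodule.projectionOnto_apply_eq_zero_iff hc.symm, map_sub,
      Submodule.projectionOnto_apply_left, sub_self]
  have hdis : ∀ v : V, v ∈ L.space → v ∈ L₁.space → v = 0 := fun v h1 h2 =>
    Submodule.disjoint_def.1 h v h1 h2
  have hdis₀ : ∀ v : V, v ∈ L₀.space → v ∈ L₁.space → v = 0 := fun v h1 h2 =>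
    Submodule.disjoint_def.1 h₀₁ v h1 h2
  refine ⟨-((L₁.space.projectionOnto L.space hc.symm).comp L₀.space.subtype), ?_, ?_⟩
  · intro v
    constructor
    · intro hv
      obtain ⟨x, hx, y, hy, rfl⟩ : ∃ x ∈ L₀.space, ∃ y ∈ L₁.space, x + y = v := by
        have : v ∈ L₀.space ⊔ L₁.space := by rw [h₀₁.isCompl.sup_eq_top]; trivial
        exact Submodule.mem_sup.1 this
      refine ⟨⟨x, hx⟩, ?_⟩
      have h3 := L.space.sub_mem hv (key x)
      have h4 := hdis _ h3 (by
        have : x + y - (x - (L₁.space.projectionOnto L.space hc.symm x : V))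
          = y + (L₁.space.projectionOnto L.space hc.symm x : V) := by abel
        rw [this]
        exact L₁.space.add_mem hy (Subtype.property _))
      have h5 := sub_eq_zero.1 h4
      rw [h5]
      simp [sub_eq_add_neg]
    · rintro ⟨x, rfl⟩
      have := key x
      simpa [sub_eq_add_neg] using this
  · intro T' hT'
    ext x
    have h1 : (x : V) + (T' x : V) ∈ L.space := (hT' _).2 ⟨x, rfl⟩
    have h3 := L.space.sub_mem h1 (key x)
    have e : (x : V) + (T' x : V) - (x - (L₁.space.projectionOnto L.space hc.symm x : V))
        = (T' x : V) + (L₁.space.projectionOnto L.space hc.symm x : V) := by abel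
    have h4 := hdis _ h3 (by
      rw [e]; exact L₁.space.add_mem (Subtype.property _) (Subtype.property _))
    rw [e] at h4
    simpa using eq_neg_of_add_eq_zero_left h4

/-- The linear map `T : L₀ → L₁` whose graph is `L`. -/
noncomputable def graphMap {V : Type*} [AddCommGroup V] [Module ℝ V] [FiniteDimensional ℝ V]
    {ω : SymplecticForm V} {L₀ L₁ L : LagrangianGrassmannian ω}
    (h₀₁ : L₀.Transverse L₁) (h : L.Transverse L₁) : L₀.space →ₗ[ℝ] L₁.space :=
  (existsUnique_isGraphOf h₀₁ h).choose

theorem isGraphOf_graphMap {V : Type*} [AddCommGroup V] [Module ℝ V] [FiniteDimensional ℝ V]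
    {ω : SymplecticForm V} {L₀ L₁ L : LagrangianGrassmannian ω}
    (h₀₁ : L₀.Transverse L₁) (h : L.Transverse L₁) : L.IsGraphOf L₀ L₁ (graphMap h₀₁ h) :=
  (existsUnique_isGraphOf h₀₁ h).choose_spec.1

/-- The chart `φ_{L₀,L₁}` of the Lagrangian Grassmannian, on the set of the Lagrangians `L` that
are transverse to `L₁`: the symmetric bilinear form `ω(T·,·)` on `L₀`, where `T : L₀ → L₁` is the
linear map with graph `L`. -/
noncomputable def chart {V : Type*} [AddCommGroup V] [Module ℝ V] [FiniteDimensional ℝ V]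
    {ω : SymplecticForm V} {L₀ L₁ : LagrangianGrassmannian ω} (h₀₁ : L₀.Transverse L₁)
    (L : LagrangianGrassmannian ω) (h : L.Transverse L₁) : BSym L₀.space :=
  ⟨ω.form.compl₁₂ (L₁.space.subtype.comp (graphMap h₀₁ h)) L₀.space.subtype, ⟨fun x y => by
    have hg := isGraphOf_graphMap h₀₁ h
    have h1 := L.2.2 _ ((hg _).2 ⟨x, rfl⟩) _ ((hg _).2 ⟨y, rfl⟩)
    have h2 := L₀.2.2 _ x.2 _ y.2
    have h3 := L₁.2.2 _ (graphMap h₀₁ h x).2 _ (graphMap h₀₁ h y).2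
    have h4 := ω.antisymm (x : V) (graphMap h₀₁ h y : V)
    simp only [map_add, LinearMap.add_apply] at h1
    simp only [LinearMap.compl₁₂_apply, LinearMap.comp_apply, Submodule.subtype_apply]
    linarith⟩⟩

/-- The manifold topology of the Lagrangian Grassmannian: the topology given by the atlas of the
charts `φ_{L₀,L₁}`. Each chart is a bijection from the set of the Lagrangians transverse to `L₁`
onto `BSym L₀`; the preimages under charts of open sets are a base of the topology. -/
instance instTopologicalSpace {V : Type*} [AddCommGroup V] [Module ℝ V] [FiniteDimensional ℝ V]
    (ω : SymplecticForm V) : TopologicalSpace (LagrangianGrassmannian ω) :=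
  TopologicalSpace.generateFrom
    {U | ∃ (L₀ L₁ : LagrangianGrassmannian ω) (h₀₁ : L₀.Transverse L₁) (W : Set (BSym L₀.space)),
      IsOpen W ∧ U = {L | ∃ h : L.Transverse L₁, chart h₀₁ L h ∈ W}}

/-- The defining properties of the `L₀`-Maslov index: a `½ℤ`-valued homomorphism on the fundamental
groupoid of the Lagrangian Grassmannian, whose value on the class of a continuous curve `γ` of
Lagrangians transverse to some `L₁` (itself transverse to `L₀`) is
`½ sign φ_{L₀,L₁}(γ(1)) - ½ sign φ_{L₀,L₁}(γ(0))`. -/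
structure IsMaslovIndex {V : Type*} [AddCommGroup V] [Module ℝ V] [FiniteDimensional ℝ V]
    {ω : SymplecticForm V} (L₀ : LagrangianGrassmannian ω)
    (μ : ∀ A B : LagrangianGrassmannian ω, Path.Homotopic.Quotient A B → ℝ) : Prop where
  half_integer : ∀ (A B : LagrangianGrassmannian ω) (p : Path.Homotopic.Quotient A B),
    ∃ k : ℤ, μ A B p = (k : ℝ) / 2
  map_trans : ∀ (A B C : LagrangianGrassmannian ω) (p : Path.Homotopic.Quotient A B)
    (q : Path.Homotopic.Quotient B C), μ A C (p.trans q) = μ A B p + μ B C q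
  map_curve : ∀ (L₁ : LagrangianGrassmannian ω) (h₀₁ : L₀.Transverse L₁)
    (A B : LagrangianGrassmannian ω) (γ : Path A B) (h : ∀ t, (γ t).Transverse L₁),
    μ A B (Path.Homotopic.Quotient.mk γ) =
      1 / 2 * (BSym.sign (chart h₀₁ (γ 1) (h 1)) : ℝ) - 1 / 2 * (BSym.sign (chart h₀₁ (γ 0) (h 0)) : ℝ)

/-- The `L₀`-Maslov index `μ_{L₀}`: the (unique) homomorphism with the properties `IsMaslovIndex`.
There is no default value: anything said about `maslovIndex` rests on its existence. -/
noncomputable def maslovIndex {V : Type*} [AddCommGroup V] [Module ℝ V] [FiniteDimensional ℝ V]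
    {ω : SymplecticForm V} (L₀ : LagrangianGrassmannian ω) :
    ∀ A B : LagrangianGrassmannian ω, Path.Homotopic.Quotient A B → ℝ :=
  Classical.epsilon L₀.IsMaslovIndex

/-- The defining property of the Hörmander index `𝔮(L₀,L₁;L₀',L₁')`: the number
`μ_{L₁}(γ) - μ_{L₀}(γ)` for any continuous curve `γ` from `L₀'` to `L₁'`. -/
def IsHormanderIndex {V : Type*} [AddCommGroup V] [Module ℝ V] [FiniteDimensional ℝ V]
    {ω : SymplecticForm V} (L₀ L₁ L₀' L₁' : LagrangianGrassmannian ω) (q : ℝ) : Prop :=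
  Nonempty (Path L₀' L₁') ∧ ∀ γ : Path L₀' L₁',
    L₁.maslovIndex L₀' L₁' (Path.Homotopic.Quotient.mk γ) -
      L₀.maslovIndex L₀' L₁' (Path.Homotopic.Quotient.mk γ) = q

/-- The Hörmander index `𝔮(L₀,L₁;L₀',L₁')`: the number with the property `IsHormanderIndex`. Again
there is no default value: anything said about it rests on the independence of the curve. -/
noncomputable def hormanderIndex {V : Type*} [AddCommGroup V] [Module ℝ V]
    [FiniteDimensional ℝ V] {ω : SymplecticForm V}
    (L₀ L₁ L₀' L₁' : LagrangianGrassmannian ω) : ℝ :=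
  Classical.epsilon (IsHormanderIndex L₀ L₁ L₀' L₁')

end LagrangianGrassmannian

/-!
Neither side of the formula can be computed before the Maslov indices are known to exist and the
Hörmander index to be independent of the curve; both follow from one identity for signatures.

If `s`, `t` are symmetric forms and `R = s⁻¹ t`, completing the square in
`t(x,x) + 2 t(x,y) + s(y,y)` in the two possible ways gives
`sgn t + sgn (s - t) = sgn s + sgn (t - t s⁻¹ t)`
(`QuadraticForm.signature_add_signature_sub`). For pairwise transverse Lagrangians `A`, `A'`, `B` and
for `X` transverse to `B`, take for `t` and `s` the forms of `X` and `A'` in the chart `φ_{A,B}`.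
Then `t - s` is congruent to `φ_{A',B}(X)`, and `t s⁻¹ t - t` to the form `v ↦ ω(a, a')` on `X`, where
`v = a + a'` with `a ∈ A`, `a' ∈ A'`. The signature of the latter, `kashiwara`, does not involve `B`:
`sign φ_{A,B}(X) - sign φ_{A',B}(X) = sign φ_{A,B}(A') - kashiwara A A' X`
(`sign_chart_sub_sign_chart`). This identity is used twice.

* *Existence of the Maslov index.* For transverse `B`, `B'` the identity shows that
  `sign φ_{A,B} - sign φ_{A,B'}` is, up to a constant, the signature of the nondegenerate form
  `φ_{B',B}(X)`, hence locally constant. For general `B`, `B'` compare with a third Lagrangian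
  transverse to all those in sight, which exists by `exists_transverse`. So the functions
  `sign φ_{A,B}` form an integral cocycle on the open cover by chart domains; it defines a covering
  space with fibre `ℤ`, and lifting paths to it gives a homomorphism on the fundamental groupoid
  (`IntCocycle.increment`), half of which is the `A`-Maslov index.
* *The Hörmander index.* For transverse `A`, `A'` the identity says that on every chart domain
  `μ_{A'} - μ_A` is the increment of the globally defined function `½ kashiwara A A'`. Hence the same
  holds for all curves (`maslovIndex_sub_maslovIndex`), and the Hörmander index of the
  theorem is `½ kashiwara L₀ L L'`, because `kashiwara L₀ L L₀ = 0`.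

Finally `kashiwara L₀ L L'` is the signature of `φ_{L,L₀}(L')`, to which
`φ_{L₁,L₀}(L') - φ_{L₁,L₀}(L)` is congruent (`sign_chart_sub_chart`).
-/

/-! ### Signatures of real quadratic forms -/

section Signature

variable {M N : Type*} [AddCommGroup M] [Module ℝ M] [AddCommGroup N] [Module ℝ N]

/-- The signature `n₋ - n₊` of a real quadratic form, with the sign convention of `BSym.sign`. -/
noncomputable def QuadraticForm.signature (Q : QuadraticForm ℝ M) : ℤ :=
  (sigNeg Q : ℤ) - (sigPos Q : ℤ)

namespace QuadraticForm

theorem signature_congr {Q : QuadraticForm ℝ M} {Q' : QuadraticForm ℝ N}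
    (e : M ≃ₗ[ℝ] N) (h : ∀ x, Q' (e x) = Q x) : Q.signature = Q'.signature := by
  have he : QuadraticMap.Equivalent Q Q' := ⟨{ e with map_app' := h }⟩
  rw [signature, signature, he.sigPos_eq, he.sigNeg_eq]

theorem signature_neg (Q : QuadraticForm ℝ M) : (-Q).signature = -Q.signature := by
  simp [signature]

theorem signature_zero : (0 : QuadraticForm ℝ M).signature = 0 := by
  have h := signature_neg (0 : QuadraticForm ℝ M)
  rw [neg_zero] at h
  omega

variable [FiniteDimensional ℝ M] [FiniteDimensional ℝ N]

theorem sigPos_prod (Q : QuadraticForm ℝ M) (Q' : QuadraticForm ℝ N) :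
    sigPos (QuadraticMap.prod Q Q') = sigPos Q + sigPos Q' := by
  obtain ⟨w, e⟩ := QuadraticForm.equivalent_weightedSumSquares Q
  obtain ⟨w', e'⟩ := QuadraticForm.equivalent_weightedSumSquares Q'
  have h : QuadraticMap.Equivalent
      (QuadraticMap.prod (QuadraticMap.weightedSumSquares ℝ w)
        (QuadraticMap.weightedSumSquares ℝ w'))
      (QuadraticMap.weightedSumSquares ℝ (Sum.elim w w')) :=
    ⟨{ (LinearEquiv.sumArrowLequivProdArrow _ _ ℝ ℝ).symm with
        map_app' := fun x => by
          simp only [QuadraticMap.weightedSumSquares_apply, QuadraticMap.prod_apply,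
            Fintype.sum_sum_type, Sum.elim_inl, Sum.elim_inr]
          rfl }⟩
  rw [sigPos_of_equiv_weightedSumSquares ((e.prod e').trans h),
    sigPos_of_equiv_weightedSumSquares e, sigPos_of_equiv_weightedSumSquares e']
  have hs : {i | 0 < Sum.elim w w' i} = Sum.inl '' {i | 0 < w i} ∪ Sum.inr '' {i | 0 < w' i} := by
    ext (i | i) <;> simp
  rw [hs, Set.ncard_union_eq, Set.ncard_image_of_injective _ Sum.inl_injective,
    Set.ncard_image_of_injective _ Sum.inr_injective]
  rw [Set.disjoint_left]
  rintro _ ⟨i, -, rfl⟩ ⟨j, -, h⟩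
  cases h

theorem sigNeg_prod (Q : QuadraticForm ℝ M) (Q' : QuadraticForm ℝ N) :
    sigNeg (QuadraticMap.prod Q Q') = sigNeg Q + sigNeg Q' := by
  have h : -(QuadraticMap.prod Q Q') = QuadraticMap.prod (-Q) (-Q') := by
    ext x
    simp [add_comm]
  rw [← sigPos_neg, h, sigPos_prod, sigPos_neg, sigPos_neg]

theorem signature_prod (Q : QuadraticForm ℝ M) (Q' : QuadraticForm ℝ N) :
    signature (QuadraticMap.prod Q Q') = Q.signature + Q'.signature := by
  simp only [signature, sigPos_prod, sigNeg_prod]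
  push_cast
  ring

/-- Completing the square in `t(x,x) + 2 t(x,y) + s(y,y)` in either variable. The hypothesis says
that `R = s⁻¹ t` whenever `s` is invertible, and the last form is then `t - t s⁻¹ t`. -/
theorem signature_add_signature_sub (s t : LinearMap.BilinForm ℝ M) (hs : s.IsSymm) (ht : t.IsSymm)
    (R : M →ₗ[ℝ] M) (hR : ∀ x y, s (R x) y = t x y) :
    signature t.toQuadraticMap + signature (s - t).toQuadraticMap =
      signature s.toQuadraticMap + signature (t.toQuadraticMap - s.toQuadraticMap.comp R) := by
  rw [← signature_prod, ← signature_prod]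
  -- In the coordinates `(x, y)` the two diagonalizations use `(x + y, y)` and `(y + R x, x)`.
  let e : (M × M) ≃ₗ[ℝ] (M × M) :=
    { toFun := fun p => (p.2 + R (p.1 - p.2), p.1 - p.2)
      map_add' := fun p q => by ext <;> simp <;> abel
      map_smul' := fun c p => by ext <;> simp [smul_sub]
      invFun := fun q => (q.1 - R q.2 + q.2, q.1 - R q.2)
      left_inv := fun p => by ext <;> simp
      right_inv := fun q => by ext <;> simp }
  refine signature_congr e fun p => ?_
  obtain ⟨u, v⟩ := p
  have h₁ := hR (u - v) v
  have h₂ := hs.eq v (R (u - v))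
  have h₃ := ht.eq u v
  simp only [e, QuadraticMap.prod_apply, sub_apply, QuadraticMap.comp_apply,
    LinearMap.BilinMap.toQuadraticMap_apply, LinearEquiv.coe_mk, LinearMap.coe_mk, AddHom.coe_mk,
    map_add, map_sub, LinearMap.add_apply, LinearMap.sub_apply] at *
  linarith

end QuadraticForm

end Signature

namespace BSym

variable {E : Type*} [AddCommGroup E] [Module ℝ E]

theorem sign_eq_signature (B : BSym E) : B.sign = QuadraticForm.signature B.1.toQuadraticMap := rfl

theorem continuous_apply_apply (x y : E) : Continuous fun B : BSym E => B.1 x y :=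
  (continuous_apply (A := fun _ : E × E => ℝ) (x, y)).comp
    (continuous_induced_dom (f := fun (B : BSym E) (p : E × E) => B.1 p.1 p.2))

/-- The negative of a symmetric bilinear form. -/
def neg (B : BSym E) : BSym E := ⟨-B.1, B.2.neg⟩

theorem index_eq_coindex_neg (B : BSym E) : B.index = B.neg.coindex := by
  rw [index, coindex, ← sigPos_neg]
  congr 1

theorem continuous_neg : Continuous (neg : BSym E → BSym E) := by
  refine continuous_induced_rng.2 (continuous_pi fun p => ?_)
  exact (continuous_apply_apply p.1 p.2).neg

variable [FiniteDimensional ℝ E]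

/-- Positive definiteness on a fixed subspace is an open condition, so `n₊` can only go up. -/
theorem eventually_coindex_le (B₀ : BSym E) : ∀ᶠ B in nhds B₀, B₀.coindex ≤ B.coindex := by
  obtain ⟨W, hW, hpos⟩ := exists_finrank_eq_sigPos_and_posDef B₀.1.toQuadraticMap
  let b := finBasis ℝ W
  let v : (Fin (finrank ℝ W) → ℝ) → W := fun c => ∑ i, c i • b i
  have hv : ∀ (B : BSym E) c, B.1 (v c : E) (v c : E) =
      ∑ i, ∑ j, c i * (c j * B.1 (b i : E) (b j : E)) := by
    intro B c
    simp only [v, Submodule.coe_sum, Submodule.coe_smul, map_sum, map_smul, LinearMap.sum_apply,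
      LinearMap.smul_apply, smul_eq_mul]
    rw [Finset.sum_comm]
    simp only [Finset.mul_sum]
    exact Finset.sum_congr rfl fun i _ => Finset.sum_congr rfl fun j _ => by ring
  have hcont : Continuous fun p : BSym E × (Fin (finrank ℝ W) → ℝ) =>
      p.1.1 (v p.2 : E) (v p.2 : E) := by
    simp only [hv]
    refine continuous_finsetSum _ fun i _ => continuous_finsetSum _ fun j _ => ?_
    have := (continuous_apply_apply (b i : E) (b j : E)).comp
      (continuous_fst (X := BSym E) (Y := Fin (finrank ℝ W) → ℝ))
    simp only [Function.comp_def] at this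
    fun_prop
  have hbij : ∀ c, c ≠ 0 → v c ≠ 0 := by
    intro c hc h
    exact hc (by simpa [v, b.equivFun_symm_apply] using
      (b.equivFun.symm.map_eq_zero_iff (x := c)).1 (by simpa [b.equivFun_symm_apply] using h))
  have hev : ∀ᶠ B in nhds B₀, ∀ c ∈ Metric.sphere (0 : Fin (finrank ℝ W) → ℝ) 1,
      0 < B.1 (v c : E) (v c : E) := by
    refine (isCompact_sphere _ _).eventually_forall_of_forall_eventually fun c hc => ?_
    refine hcont.continuousAt.eventually (lt_mem_nhds ?_)
    refine hpos (v c) (hbij c ?_)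
    rintro rfl
    simp at hc
  filter_upwards [hev] with B hB
  rw [coindex, ← hW]
  refine le_sigPos_of_posDef _ fun w hw => ?_
  change 0 < B.1 (w : E) (w : E)
  have hc : b.equivFun w ≠ 0 := by simpa using hw
  have hn : 0 < ‖b.equivFun w‖ := norm_pos_iff.2 hc
  have h := hB (‖b.equivFun w‖⁻¹ • b.equivFun w) (by
    rw [mem_sphere_zero_iff_norm, norm_smul, norm_inv, norm_norm, inv_mul_cancel₀ hn.ne'])
  have hw' : v (‖b.equivFun w‖⁻¹ • b.equivFun w) = ‖b.equivFun w‖⁻¹ • w := by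
    have := b.equivFun_symm_apply (‖b.equivFun w‖⁻¹ • b.equivFun w)
    rw [map_smul, LinearEquiv.symm_apply_apply] at this
    exact this.symm
  rw [hw'] at h
  simp only [Submodule.coe_smul, map_smul, LinearMap.smul_apply, smul_eq_mul] at h
  have h2 := inv_pos.2 hn
  exact (mul_pos_iff_of_pos_left h2).1 ((mul_pos_iff_of_pos_left h2).1 h)

theorem eventually_index_le (B₀ : BSym E) : ∀ᶠ B in nhds B₀, B₀.index ≤ B.index := by
  simp only [index_eq_coindex_neg]
  exact continuous_neg.continuousAt.eventually (eventually_coindex_le B₀.neg)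

/-- The signature is locally constant at the nondegenerate forms: neither `n₊` nor `n₋` can drop,
and their sum is already maximal. -/
theorem eventually_sign_eq (B₀ : BSym E) (h₀ : ∀ x, (∀ y, B₀.1 x y = 0) → x = 0) :
    ∀ᶠ B in nhds B₀, B.sign = B₀.sign := by
  have hrad : B₀.1.toQuadraticMap.radical = ⊥ := by
    rw [eq_bot_iff]
    intro x hx
    refine h₀ x fun y => ?_
    have h := (QuadraticMap.mem_radical_iff'.1 hx).2 y
    have h' := (QuadraticMap.mem_radical_iff'.1 hx).1
    have hs := B₀.2.eq x y
    simp only [LinearMap.BilinMap.toQuadraticMap_apply, map_add, LinearMap.add_apply] at h h'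
    linarith
  have h₁ := QuadraticForm.sigPos_add_sigNeg_add_radical (Q := B₀.1.toQuadraticMap)
  rw [hrad, finrank_bot] at h₁
  filter_upwards [eventually_coindex_le B₀, eventually_index_le B₀] with B hp hn
  have h₂ := QuadraticForm.sigPos_add_sigNeg_add_radical (Q := B.1.toQuadraticMap)
  simp only [sign, coindex, index] at *
  omega

end BSym

/-! ### Homomorphisms on the fundamental groupoid from locally compatible functions -/

section GroupoidHomomorphism

open unitInterval Topology

/-- An open cover `U i` of a space together with functions `f i : U i → ℤ` whose differences on
the overlaps are locally constant. (The functions are total; only their values on `U i` matter.) -/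
structure IntCocycle (ι X : Type*) [TopologicalSpace X] where
  U : ι → Set X
  f : ι → X → ℤ
  isOpen_U : ∀ i, IsOpen (U i)
  exists_mem : ∀ x, ∃ i, x ∈ U i
  locally_const : ∀ i j, ∀ x ∈ U i ∩ U j, ∀ᶠ y in 𝓝 x, f i y - f j y = f i x - f j x

namespace IntCocycle

variable {ι X : Type*} [TopologicalSpace X] (c : IntCocycle ι X)

/-- A primitive of the cocycle along a map `φ` into `X`: a function which differs from each
`f i ∘ φ` by a locally constant function. -/
def IsPrimitive {Y : Type*} [TopologicalSpace Y] (φ : Y → X) (g : Y → ℤ) : Prop :=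
  ∀ y i, φ y ∈ c.U i → ∀ᶠ z in 𝓝 y, g z - c.f i (φ z) = g y - c.f i (φ y)

variable {c}

theorem IsPrimitive.comp {Y Z : Type*} [TopologicalSpace Y] [TopologicalSpace Z] {φ : Y → X}
    {g : Y → ℤ} (hg : c.IsPrimitive φ g) {ψ : Z → Y} (hψ : Continuous ψ) :
    c.IsPrimitive (φ ∘ ψ) (g ∘ ψ) :=
  fun z i hi => hψ.continuousAt.eventually (hg (ψ z) i hi)

theorem IsPrimitive.sub_eq {Y : Type*} [TopologicalSpace Y] [PreconnectedSpace Y] {φ : Y → X}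
    {g g' : Y → ℤ} (hg : c.IsPrimitive φ g) (hg' : c.IsPrimitive φ g') (y z : Y) :
    g z - g y = g' z - g' y := by
  have h : IsLocallyConstant fun y => g y - g' y := by
    refine (IsLocallyConstant.iff_eventually_eq _).2 fun y => ?_
    obtain ⟨i, hi⟩ := c.exists_mem (φ y)
    filter_upwards [hg y i hi, hg' y i hi] with z h h'
    omega
  have := h.apply_eq_of_preconnectedSpace z y
  omega

variable (c)

/-- The covering space with fibre `ℤ` whose local sections are the translates of the `f i`: a point
over `x` with coordinate `v` in the `i`-th trivialization stands for the value `v + f i x`. -/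
noncomputable def bundleCore : FiberBundleCore ι X ℤ where
  baseSet := c.U
  isOpen_baseSet := c.isOpen_U
  indexAt x := (c.exists_mem x).choose
  mem_baseSet_at x := (c.exists_mem x).choose_spec
  coordChange i j x v := v + (c.f i x - c.f j x)
  coordChange_self i x _ v := by simp
  continuousOn_coordChange i j := by
    rintro ⟨x, v⟩ ⟨hx, -⟩
    refine ContinuousAt.continuousWithinAt ?_
    refine continuousAt_snd.add ?_
    refine ContinuousAt.congr (f := fun _ => c.f i x - c.f j x) continuousAt_const ?_
    have := (continuousAt_fst (p := (x, v))).eventually (c.locally_const i j x hx)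
    filter_upwards [this] with p hp using hp.symm
  coordChange_comp i j k x _ v := by ring

theorem isCoveringMap_proj :
    IsCoveringMap (Bundle.TotalSpace.proj : c.bundleCore.TotalSpace → X) :=
  IsCoveringMap.mk _ (fun _ => ℤ) c.bundleCore.localTrivAt
    fun x => c.bundleCore.mem_localTrivAt_baseSet x

/-- The value at a point of the covering space, independent of the trivialization. -/
noncomputable def value (e : c.bundleCore.TotalSpace) : ℤ :=
  (show ℤ from e.2) + c.f (c.bundleCore.indexAt e.1) e.1

theorem isPrimitive_value {Y : Type*} [TopologicalSpace Y] {Γ : Y → c.bundleCore.TotalSpace}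
    (hΓ : Continuous Γ) : c.IsPrimitive (fun y => (Γ y).proj) (fun y => c.value (Γ y)) := by
  intro y i hi
  let T := c.bundleCore.localTriv i
  have hsrc : Γ y ∈ T.source := T.mem_source.2 hi
  have hval : ∀ e : c.bundleCore.TotalSpace, (T e).2 = c.value e - c.f i e.proj := by
    intro e
    have : (T e).2 = (show ℤ from e.2) + (c.f (c.bundleCore.indexAt e.1) e.1 - c.f i e.1) := rfl
    rw [this, value]
    ring
  have hcont : ContinuousAt (fun z => (T (Γ z)).2) y :=
    continuousAt_snd.comp
      ((T.continuousOn_toFun.continuousAt (T.open_source.mem_nhds hsrc)).comp hΓ.continuousAt)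
  have := hcont.eventually (show ∀ᶠ k in 𝓝 (T (Γ y)).2, k = (T (Γ y)).2 by simp)
  filter_upwards [this] with z hz
  rwa [hval, hval] at hz

/-- The value along a lift of the path to the covering space is a primitive. -/
theorem exists_isPrimitive {a b : X} (γ : Path a b) : ∃ g, c.IsPrimitive γ g := by
  let e : c.bundleCore.TotalSpace := ⟨a, (0 : ℤ)⟩
  have h₀ : γ.toContinuousMap 0 = e.proj := γ.source
  have hl := c.isCoveringMap_proj.liftPath_lifts γ.toContinuousMap e h₀
  have h := c.isPrimitive_value (c.isCoveringMap_proj.liftPath γ.toContinuousMap e h₀).continuous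
  have h' : (fun y => ((c.isCoveringMap_proj.liftPath γ.toContinuousMap e h₀) y).proj) = γ := hl
  rw [h'] at h
  exact ⟨_, h⟩

/-- Homotopic paths have lifts with the same endpoints. -/
theorem sub_eq_of_homotopic {a b : X} {γ γ' : Path a b} (h : γ.Homotopic γ') {g g' : I → ℤ}
    (hg : c.IsPrimitive γ g) (hg' : c.IsPrimitive γ' g') : g 1 - g 0 = g' 1 - g' 0 := by
  let e : c.bundleCore.TotalSpace := ⟨a, (0 : ℤ)⟩
  have key : ∀ (γ : Path a b) (h₀ : γ.toContinuousMap 0 = e.proj) (g : I → ℤ),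
      c.IsPrimitive γ g →
      g 1 - g 0 = c.value (c.isCoveringMap_proj.liftPath γ.toContinuousMap e h₀ 1) - c.value e := by
    intro γ h₀ g hg
    have hl := c.isCoveringMap_proj.liftPath_lifts γ.toContinuousMap e h₀
    have := c.isPrimitive_value (c.isCoveringMap_proj.liftPath γ.toContinuousMap e h₀).continuous
    have h2 : (fun y => ((c.isCoveringMap_proj.liftPath γ.toContinuousMap e h₀) y).proj) = γ := hl
    rw [h2] at this
    rw [hg.sub_eq this 0 1, c.isCoveringMap_proj.liftPath_zero]
  rw [key γ γ.source g hg, key γ' γ'.source g' hg',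
    c.isCoveringMap_proj.liftPath_apply_one_eq_of_homotopicRel h e γ.source γ'.source]

/-- The increment of the cocycle along a homotopy class of paths. -/
noncomputable def increment {a b : X} (p : Path.Homotopic.Quotient a b) : ℤ :=
  Quotient.lift (fun γ : Path a b => (c.exists_isPrimitive γ).choose 1 -
    (c.exists_isPrimitive γ).choose 0) (fun γ γ' h => c.sub_eq_of_homotopic h
      (c.exists_isPrimitive γ).choose_spec (c.exists_isPrimitive γ').choose_spec) p

theorem increment_mk {a b : X} {γ : Path a b} {g : I → ℤ} (hg : c.IsPrimitive γ g) :
    c.increment (Path.Homotopic.Quotient.mk γ) = g 1 - g 0 :=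
  (c.exists_isPrimitive γ).choose_spec.sub_eq hg 0 1

theorem increment_trans {a b d : X} (p : Path.Homotopic.Quotient a b)
    (q : Path.Homotopic.Quotient b d) :
    c.increment (p.trans q) = c.increment p + c.increment q := by
  obtain ⟨γ, rfl⟩ := Path.Homotopic.Quotient.mk_surjective p
  obtain ⟨γ', rfl⟩ := Path.Homotopic.Quotient.mk_surjective q
  obtain ⟨g, hg⟩ := c.exists_isPrimitive (γ.trans γ')
  let l : I → I := fun t => ⟨t / 2, by constructor <;> linarith [t.2.1, t.2.2]⟩
  let r : I → I := fun t => ⟨(t + 1) / 2, by constructor <;> linarith [t.2.1, t.2.2]⟩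
  have hl : c.IsPrimitive γ (g ∘ l) := by
    have h : γ.trans γ' ∘ l = γ := by
      ext t
      have ht : ((l t : I) : ℝ) ≤ 1 / 2 := by simp only [l]; linarith [t.2.2]
      rw [Function.comp_apply, Path.trans_apply, dif_pos ht]
      congr 1
      ext
      simp only [l]
      ring
    rw [← h]
    exact hg.comp (by fun_prop)
  have hr : c.IsPrimitive γ' (g ∘ r) := by
    have h : γ.trans γ' ∘ r = γ' := by
      ext t
      rw [Function.comp_apply, Path.trans_apply]
      split_ifs with ht
      · have h0 : t = 0 := by
          ext
          simp only [r] at ht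
          change (t : ℝ) = 0
          linarith [t.2.1]
        subst h0
        simp [r]
      · congr 1
        ext
        simp only [r]
        ring
    rw [← h]
    exact hg.comp (by fun_prop)
  rw [← Path.Homotopic.Quotient.mk_trans, c.increment_mk hg, c.increment_mk hl, c.increment_mk hr]
  have h0 : l 0 = 0 := by ext; simp [l]
  have h1 : r 1 = 1 := by ext; simp [r]
  have hm : l 1 = r 0 := by ext; simp [l, r]
  simp only [Function.comp_apply, h0, h1, hm]
  ring

theorem increment_of_forall_mem {a b : X} (γ : Path a b) (i : ι) (h : ∀ t, γ t ∈ c.U i) :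
    c.increment (Path.Homotopic.Quotient.mk γ) = c.f i (γ 1) - c.f i (γ 0) := by
  refine c.increment_mk (g := c.f i ∘ γ) fun t j hj => ?_
  exact γ.continuous.continuousAt.eventually (c.locally_const i j _ ⟨h t, hj⟩)

end IntCocycle

/-- A homomorphism `ν` on the fundamental groupoid which is, on short paths, the difference of the
values of a global function `H` at the endpoints, is so on all paths. -/
theorem eq_sub_of_locally_eq_sub {X : Type*} [TopologicalSpace X]
    (ν : ∀ a b : X, Path.Homotopic.Quotient a b → ℝ) (H : X → ℝ)
    (hν : ∀ a b d (p : Path.Homotopic.Quotient a b) (q : Path.Homotopic.Quotient b d),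
      ν a d (p.trans q) = ν a b p + ν b d q)
    (hloc : ∀ x, ∃ U ∈ 𝓝 x, ∀ (a b : X) (γ : Path a b), (∀ t, γ t ∈ U) →
      ν a b (Path.Homotopic.Quotient.mk γ) = H b - H a)
    {a b : X} (γ : Path a b) : ν a b (Path.Homotopic.Quotient.mk γ) = H b - H a := by
  have hsub : ∀ t₀ t₁ t₂ : I, ν _ _ (Path.Homotopic.Quotient.mk (γ.subpath t₀ t₂)) =
      ν _ _ (Path.Homotopic.Quotient.mk (γ.subpath t₀ t₁)) +
        ν _ _ (Path.Homotopic.Quotient.mk (γ.subpath t₁ t₂)) := by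
    intro t₀ t₁ t₂
    rw [← hν, ← Path.Homotopic.Quotient.mk_trans]
    congr 1
    exact (Path.Homotopic.Quotient.eq.2 ⟨Path.Homotopy.subpathTransSubpath γ t₀ t₁ t₂⟩).symm
  have hcast : ∀ (a' b' : X) (ha : a' = a) (hb : b' = b),
      ν a' b' (Path.Homotopic.Quotient.mk (γ.cast ha hb)) =
        ν a b (Path.Homotopic.Quotient.mk γ) := by
    intro a' b' ha hb
    subst ha hb
    rfl
  have hlc : IsLocallyConstant fun t : I =>
      ν _ _ (Path.Homotopic.Quotient.mk (γ.subpath 0 t)) - H (γ t) := by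
    refine (IsLocallyConstant.iff_eventually_eq _).2 fun t => ?_
    obtain ⟨U, hU, h⟩ := hloc (γ t)
    have hmem : γ ⁻¹' U ∈ 𝓝 t := γ.continuous.continuousAt hU
    have hsmall := Filter.tendsto_smallSets_iff.1
      ((tendsto_const_nhds (x := t)).uIcc (Filter.tendsto_id (x := 𝓝 t))) _ hmem
    filter_upwards [hsmall] with s hs
    have hγ : ∀ r, γ.subpath t s r ∈ U := fun r => by
      have hr := Set.mem_range_self (f := γ.subpath t s) r
      rw [Path.range_subpath] at hr
      obtain ⟨r', hr', heq⟩ := hr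
      rw [← heq]
      exact hs hr'
    rw [hsub 0 t s, h _ _ _ hγ]
    ring
  have h := hlc.apply_eq_of_preconnectedSpace 1 0
  have h0 := hsub 0 0 0
  have h1 := hcast _ _ γ.source γ.target
  rw [← Path.subpath_zero_one] at h1
  simp only [γ.source, γ.target] at h
  linarith

end GroupoidHomomorphism

/-! ### Lagrangians transverse to finitely many given ones -/

namespace LagrangianGrassmannian

variable {V : Type*} [AddCommGroup V] [Module ℝ V] {ω : SymplecticForm V}

theorem Transverse.symm {A B : LagrangianGrassmannian ω} (h : A.Transverse B) : B.Transverse A :=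
  Disjoint.symm h

theorem form_self (ω : SymplecticForm V) (v : V) : ω.form v v = 0 := by
  have := ω.antisymm v v
  linarith

theorem form_isRefl (ω : SymplecticForm V) : ω.form.IsRefl := fun v w h => by
  rw [ω.antisymm, h, neg_zero]

variable [FiniteDimensional ℝ V]

/-- An isotropic subspace `W` that meets the Lagrangian `L` trivially and is not itself Lagrangian
has an orthogonal which is not contained in `W + L`: otherwise a nonzero vector of `W^ω ∩ L` would
be orthogonal to `W + L ⊇ W^ω`, and so lie in `W ∩ L`. -/
theorem not_orthogonal_le_sup (L : LagrangianGrassmannian ω) {W : Submodule ℝ V}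
    (hd : Disjoint W L.space) (hlt : finrank ℝ W < finrank ℝ L.space) :
    ¬ ω.form.orthogonal W ≤ W ⊔ L.space := by
  intro hle
  have hL : 2 * finrank ℝ L.space = finrank ℝ V := L.2.1
  have hdim := LinearMap.BilinForm.finrank_orthogonal ω.nondegenerate W
  have hnd : ¬ Disjoint (ω.form.orthogonal W) L.space := by
    intro h
    have := Submodule.finrank_add_finrank_le_of_disjoint h
    omega
  refine hnd (Submodule.disjoint_def.2 fun u hu huL => ?_)
  refine Submodule.disjoint_def.1 hd u ?_ huL
  rw [← LinearMap.BilinForm.orthogonal_orthogonal ω.nondegenerate (form_isRefl ω) W]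
  intro v hv
  obtain ⟨w, hw, l, hl, rfl⟩ := Submodule.mem_sup.1 (hle hv)
  have h₁ : ω.form w u = 0 := hu w hw
  have h₂ : ω.form l u = 0 := L.2.2 l hl u huL
  simp [h₁, h₂]

theorem exists_isotropic_disjoint {ι : Type*} [Finite ι] [Nonempty ι]
    (L : ι → LagrangianGrassmannian ω) (k : ℕ) (hk : 2 * k ≤ finrank ℝ V) :
    ∃ W : Submodule ℝ V, finrank ℝ W = k ∧ (∀ v ∈ W, ∀ w ∈ W, ω.form v w = 0) ∧
      ∀ i, Disjoint W (L i).space := by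
  induction k with
  | zero =>
    exact ⟨⊥, finrank_bot ℝ V, by simp, fun i => disjoint_bot_left⟩
  | succ k ih =>
    obtain ⟨W, hWk, hiso, hdis⟩ := ih (by omega)
    let p : ι → Submodule ℝ (ω.form.orthogonal W) := fun i =>
      (W ⊔ (L i).space).comap (ω.form.orthogonal W).subtype
    have hp : ⊤ ∉ (Set.finite_range p).toFinset := by
      rw [Set.Finite.mem_toFinset]
      rintro ⟨i, hi⟩
      have hL : 2 * finrank ℝ (L i).space = finrank ℝ V := (L i).2.1
      refine not_orthogonal_le_sup (L i) (hdis i) (by omega) fun v hv => ?_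
      have : (⟨v, hv⟩ : ω.form.orthogonal W) ∈ p i := hi ▸ Submodule.mem_top
      exact this
    -- A vector space over an infinite field is no finite union of proper subspaces.
    have hne := Subspace.biUnion_ne_univ_of_top_notMem hp
    obtain ⟨⟨v, hv⟩, hvp⟩ := (Set.ne_univ_iff_exists_notMem _).1 hne
    have hvL : ∀ i, v ∉ W ⊔ (L i).space := fun i hi => hvp (by
      simp only [Set.Finite.mem_toFinset, Set.mem_iUnion]
      exact ⟨p i, ⟨i, rfl⟩, hi⟩)
    have hvW : v ∉ W := fun h =>
      hvL (Classical.arbitrary ι) (le_sup_left (a := W) h)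
    have hv0 : v ≠ 0 := fun h => hvW (h ▸ W.zero_mem)
    have hsmul : ∀ (U : Submodule ℝ V) (c : ℝ), v ∉ U → c • v ∈ U → c = 0 := by
      intro U c hU hc
      by_contra h
      exact hU ((U.smul_mem_iff h).1 hc)
    refine ⟨W ⊔ Submodule.span ℝ {v}, ?_, ?_, fun i => ?_⟩
    · have hinf : W ⊓ Submodule.span ℝ {v} = ⊥ := by
        rw [eq_bot_iff]
        rintro x ⟨hx, hx'⟩
        obtain ⟨c, rfl⟩ := Submodule.mem_span_singleton.1 hx'
        simp [hsmul W c hvW hx]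
      have := Submodule.finrank_sup_add_finrank_inf_eq W (Submodule.span ℝ {v})
      rw [hinf, finrank_bot, finrank_span_singleton hv0] at this
      omega
    · have hWv : ∀ w ∈ W, ω.form w v = 0 := fun w hw => hv w hw
      have hvW' : ∀ w ∈ W, ω.form v w = 0 := fun w hw => form_isRefl ω _ _ (hWv w hw)
      intro x hx y hy
      obtain ⟨w, hw, z, hz, rfl⟩ := Submodule.mem_sup.1 hx
      obtain ⟨w', hw', z', hz', rfl⟩ := Submodule.mem_sup.1 hy
      obtain ⟨c, rfl⟩ := Submodule.mem_span_singleton.1 hz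
      obtain ⟨c', rfl⟩ := Submodule.mem_span_singleton.1 hz'
      simp [hiso w hw w' hw', hWv w hw, hvW' w' hw', form_self ω v]
    · refine Submodule.disjoint_def.2 fun x hx hxL => ?_
      obtain ⟨w, hw, z, hz, rfl⟩ := Submodule.mem_sup.1 hx
      obtain ⟨c, rfl⟩ := Submodule.mem_span_singleton.1 hz
      have hc : c = 0 := by
        refine hsmul _ c (hvL i) ?_
        have h := (W ⊔ (L i).space).sub_mem (le_sup_right (a := W) hxL) (le_sup_left (a := W) hw)
        rwa [add_sub_cancel_left] at h
      subst hc
      rw [zero_smul, add_zero] at hxL ⊢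
      exact Submodule.disjoint_def.1 (hdis i) w hw hxL

theorem exists_transverse {ι : Type*} [Finite ι] [Nonempty ι] (L : ι → LagrangianGrassmannian ω) :
    ∃ C : LagrangianGrassmannian ω, ∀ i, (L i).Transverse C := by
  have hL : 2 * finrank ℝ (L (Classical.arbitrary ι)).space = finrank ℝ V := (L _).2.1
  obtain ⟨W, hW, hiso, hdis⟩ :=
    exists_isotropic_disjoint L (finrank ℝ (L (Classical.arbitrary ι)).space) hL.le
  exact ⟨⟨W, by rw [hW, hL], hiso⟩, fun i => (hdis i).symm⟩

/-! ### Signatures of the charts -/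

theorem add_graphMap_mem {A B X : LagrangianGrassmannian ω} (hAB : A.Transverse B)
    (hX : X.Transverse B) (x : A.space) : (x : V) + (graphMap hAB hX x : V) ∈ X.space :=
  (isGraphOf_graphMap hAB hX _).2 ⟨x, rfl⟩

theorem graphMap_eq_of_add_mem {A B X : LagrangianGrassmannian ω} (hAB : A.Transverse B)
    (hX : X.Transverse B) {x : A.space} {y : B.space} (h : (x : V) + y ∈ X.space) :
    graphMap hAB hX x = y := by
  have h₁ := X.space.sub_mem (add_graphMap_mem hAB hX x) h
  rw [add_sub_add_left_eq_sub] at h₁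
  exact Subtype.ext (sub_eq_zero.1 (Submodule.disjoint_def.1 hX _ h₁
    (B.space.sub_mem (Subtype.property _) (Subtype.property _))))

/-- The isomorphism `x ↦ x + T x` from `A` onto the graph `X` of `T : A → B`. -/
noncomputable def graphEquiv {A B X : LagrangianGrassmannian ω} (hAB : A.Transverse B)
    (hX : X.Transverse B) : A.space ≃ₗ[ℝ] X.space :=
  LinearEquiv.ofBijective
    ((A.space.subtype + B.space.subtype.comp (graphMap hAB hX)).codRestrict X.space
      (add_graphMap_mem hAB hX)) (by
    constructor
    · rw [← LinearMap.ker_eq_bot, LinearMap.ker_eq_bot']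
      intro x hx
      have h : (x : V) + (graphMap hAB hX x : V) = 0 := congrArg Subtype.val hx
      have hB : (x : V) ∈ B.space := by
        rw [eq_neg_of_add_eq_zero_left h]
        exact B.space.neg_mem (Subtype.property _)
      exact Subtype.ext (Submodule.disjoint_def.1 hAB _ x.2 hB)
    · rintro ⟨v, hv⟩
      obtain ⟨x, rfl⟩ := (isGraphOf_graphMap hAB hX v).1 hv
      exact ⟨x, rfl⟩)

theorem coe_graphEquiv {A B X : LagrangianGrassmannian ω} (hAB : A.Transverse B)
    (hX : X.Transverse B) (x : A.space) :
    (graphEquiv hAB hX x : V) = x + graphMap hAB hX x := rfl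

theorem chart_apply {A B X : LagrangianGrassmannian ω} (hAB : A.Transverse B)
    (hX : X.Transverse B) (x y : A.space) :
    (chart hAB X hX).1 x y = ω.form (graphMap hAB hX x : V) (y : V) := rfl

/-- Changing the base Lagrangian `A` of the charts with the same `B` is, up to a congruence, a
translation. -/
theorem sign_chart_sub_chart {A A' B X : LagrangianGrassmannian ω} (hAB : A.Transverse B)
    (hA' : A'.Transverse B) (hX : X.Transverse B) :
    (chart hAB X hX - chart hAB A' hA').sign = (chart hA' X hX).sign := by
  refine QuadraticForm.signature_congr (graphEquiv hAB hA') fun x => ?_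
  change ω.form (graphMap hA' hX (graphEquiv hAB hA' x) : V) (graphEquiv hAB hA' x : V) =
    ω.form (graphMap hAB hX x : V) (x : V) - ω.form (graphMap hAB hA' x : V) (x : V)
  have hT : graphMap hA' hX (graphEquiv hAB hA' x) = graphMap hAB hX x - graphMap hAB hA' x := by
    refine graphMap_eq_of_add_mem hA' hX ?_
    have := add_graphMap_mem hAB hX x
    rw [coe_graphEquiv]
    convert this using 1
    push_cast
    abel
  have hB := B.2.2 _ (graphMap hAB hX x - graphMap hAB hA' x).2 _ (graphMap hAB hA' x).2
  rw [hT, coe_graphEquiv, map_add, hB]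
  simp

/-- The Kashiwara index, up to sign, of `A`, `X`, `A'` for transverse `A`, `A'` and arbitrary `X`:
the signature on `X` of the quadratic form `v ↦ ω(a, a')`, where `v = a + a'` with `a ∈ A` and
`a' ∈ A'`. -/
noncomputable def kashiwara {A A' : LagrangianGrassmannian ω} (h : A.Transverse A')
    (X : LagrangianGrassmannian ω) : ℤ :=
  QuadraticForm.signature (LinearMap.BilinMap.toQuadraticMap (ω.form.compl₁₂
    (A.space.subtype ∘ₗ A.space.projectionOnto A'.space h.isCompl ∘ₗ X.space.subtype)
    (A'.space.subtype ∘ₗ A'.space.projectionOnto A.space h.isCompl.symm ∘ₗ X.space.subtype)))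

/-- The Kashiwara index through any parametrization of `X`. -/
theorem kashiwara_eq {A A' X : LagrangianGrassmannian ω} (h : A.Transverse A') {E : Type*}
    [AddCommGroup E] [Module ℝ E] (Q : QuadraticForm ℝ E) (e : E ≃ₗ[ℝ] X.space)
    (a : E → A.space) (a' : E → A'.space) (he : ∀ x, (e x : V) = a x + a' x)
    (hQ : ∀ x, Q x = ω.form (a x : V) (a' x : V)) :
    kashiwara h X = QuadraticForm.signature Q := by
  refine (QuadraticForm.signature_congr e fun x => ?_).symm
  change ω.form (A.space.projectionOnto A'.space h.isCompl (e x) : V)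
    (A'.space.projectionOnto A.space h.isCompl.symm (e x) : V) = _
  rw [hQ, he, map_add, map_add]
  simp

theorem kashiwara_self {A A' : LagrangianGrassmannian ω} (h : A.Transverse A') :
    kashiwara h A = 0 := by
  rw [kashiwara_eq h (0 : QuadraticForm ℝ A.space) (LinearEquiv.refl ℝ _) id 0 (by simp) (by simp),
    QuadraticForm.signature_zero]

theorem kashiwara_eq_sign_chart {A A' X : LagrangianGrassmannian ω} (h : A.Transverse A')
    (hX : X.Transverse A) : kashiwara h X = (chart h.symm X hX).sign :=
  kashiwara_eq h _ (graphEquiv h.symm hX) (graphMap h.symm hX) id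
    (fun x => by rw [coe_graphEquiv, add_comm]; rfl) (fun _ => rfl)

/-- The cocycle identity for the signatures of the charts, for pairwise transverse `A`, `A'`, `B`:
the identity `sgn t + sgn (s - t) = sgn s + sgn (t - t s⁻¹ t)` for `t` and `s` the forms of `X` and
`A'` in the chart `φ_{A,B}`. -/
theorem sign_chart_sub_sign_chart {A A' B X : LagrangianGrassmannian ω} (h : A.Transverse A')
    (hAB : A.Transverse B) (hA' : A'.Transverse B) (hX : X.Transverse B) :
    (chart hAB X hX).sign - (chart hA' X hX).sign =
      (chart hAB A' hA').sign - kashiwara h X := by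
  let S := graphMap hAB hA'
  let T := graphMap hAB hX
  have hS : Function.Injective S := by
    rw [← LinearMap.ker_eq_bot, LinearMap.ker_eq_bot']
    intro x hx
    have h₁ := add_graphMap_mem hAB hA' x
    rw [show graphMap hAB hA' x = 0 from hx, Submodule.coe_zero, add_zero] at h₁
    exact Subtype.ext (Submodule.disjoint_def.1 h _ x.2 h₁)
  have hdim : finrank ℝ A.space = finrank ℝ B.space := by
    have h₁ : 2 * finrank ℝ A.space = finrank ℝ V := A.2.1
    have h₂ : 2 * finrank ℝ B.space = finrank ℝ V := B.2.1
    omega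
  let R : A.space →ₗ[ℝ] A.space := (LinearMap.linearEquivOfInjective S hS hdim).symm.toLinearMap ∘ₗ T
  have hR : ∀ x, S (R x) = T x := fun x =>
    (LinearMap.linearEquivOfInjective S hS hdim).apply_symm_apply (T x)
  have hst : ∀ x y, (chart hAB A' hA').1 (R x) y = (chart hAB X hX).1 x y := by
    intro x y
    rw [chart_apply, chart_apply]
    exact congrArg (fun b : B.space => ω.form (b : V) (y : V)) (hR x)
  have key := QuadraticForm.signature_add_signature_sub (chart hAB A' hA').1 (chart hAB X hX).1
    (chart hAB A' hA').2 (chart hAB X hX).2 R hst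
  have h₁ : QuadraticForm.signature
      ((chart hAB A' hA').1 - (chart hAB X hX).1).toQuadraticMap = -(chart hA' X hX).sign := by
    rw [← sign_chart_sub_chart hAB hA' hX, BSym.sign_eq_signature, ← QuadraticForm.signature_neg]
    congr 1
    ext x
    change (chart hAB A' hA').1 x x - (chart hAB X hX).1 x x =
      -((chart hAB X hX).1 x x - (chart hAB A' hA').1 x x)
    ring
  have h₂ : QuadraticForm.signature ((chart hAB X hX).1.toQuadraticMap -
      (chart hAB A' hA').1.toQuadraticMap.comp R) = -kashiwara h X := by
    rw [← neg_eq_iff_eq_neg, ← QuadraticForm.signature_neg, eq_comm]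
    -- `x + T x = (x - R x) + (R x + S (R x))` with the summands in `A` and `A'`.
    refine kashiwara_eq h _ (graphEquiv hAB hX) (fun x => x - R x)
      (fun x => graphEquiv hAB hA' (R x)) (fun x => ?_) fun x => ?_
    · have := congrArg (Subtype.val : B.space → V) (hR x)
      rw [coe_graphEquiv, coe_graphEquiv]
      change (x : V) + (T x : V) = ((x - R x : A.space) : V) + ((R x : V) + (S (R x) : V))
      rw [this]
      push_cast
      abel
    · have hx := hst x (R x)
      have hA := A.2.2 _ (x - R x).2 _ (R x).2
      have e₁ : ω.form ((x - R x : A.space) : V) (graphMap hAB hA' (R x) : V) =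
          -ω.form (T x : V) ((x - R x : A.space) : V) := by
        rw [ω.antisymm]
        exact congrArg (fun b : B.space => -ω.form (b : V) ((x - R x : A.space) : V)) (hR x)
      rw [coe_graphEquiv, map_add, hA, e₁]
      change -((chart hAB X hX).1 x x - (chart hAB A' hA').1 (R x) (R x)) =
        0 + -(chart hAB X hX).1 x (x - R x)
      rw [map_sub, hx]
      ring
  rw [h₁, h₂] at key
  simp only [BSym.sign_eq_signature] at *
  linarith

/-- The comparison of the charts `φ_{A,B}` and `φ_{A,B'}` for transverse `B`, `B'`. -/
theorem sign_chart_sub_sign_chart_right {A B B' X : LagrangianGrassmannian ω}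
    (hAB : A.Transverse B) (hAB' : A.Transverse B') (h : B'.Transverse B)
    (hX : X.Transverse B) (hX' : X.Transverse B') :
    (chart hAB X hX).sign - (chart hAB' X hX').sign =
      (chart h X hX).sign - (chart h A hAB).sign := by
  have h₁ := sign_chart_sub_sign_chart hAB'.symm h hAB hX
  rw [kashiwara_eq_sign_chart hAB'.symm hX'] at h₁
  linarith

end LagrangianGrassmannian

/-! ### The Maslov index -/

namespace LagrangianGrassmannian

open Topology unitInterval

variable {V : Type*} [AddCommGroup V] [Module ℝ V] [FiniteDimensional ℝ V] {ω : SymplecticForm V}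

theorem isOpen_chart_preimage {A B : LagrangianGrassmannian ω} (h : A.Transverse B)
    {W : Set (BSym A.space)} (hW : IsOpen W) :
    IsOpen {X : LagrangianGrassmannian ω | ∃ hX : X.Transverse B, chart h X hX ∈ W} :=
  TopologicalSpace.isOpen_generateFrom_of_mem ⟨A, B, h, W, hW, rfl⟩

theorem isOpen_setOf_transverse {A B : LagrangianGrassmannian ω} (h : A.Transverse B) :
    IsOpen {X : LagrangianGrassmannian ω | X.Transverse B} := by
  simpa using isOpen_chart_preimage h isOpen_univ

/-- If `X` is transverse to `A` as well, then its form in the chart `φ_{A,B}` is nondegenerate. -/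
theorem eventually_sign_chart_eq {A B X : LagrangianGrassmannian ω} (h : A.Transverse B)
    (hX : X.Transverse B) (hXA : X.Transverse A) :
    ∀ᶠ Y in 𝓝 X, ∀ hY : Y.Transverse B, (chart h Y hY).sign = (chart h X hX).sign := by
  have hnd : ∀ x, (∀ y, (chart h X hX).1 x y = 0) → x = 0 := by
    intro x hx
    -- `T x` is orthogonal to `A` and to `B`, which span `V`.
    have hT : (graphMap h hX x : V) = 0 := by
      refine ω.nondegenerate.1 _ fun v => ?_
      obtain ⟨a, ha, b, hb, rfl⟩ : ∃ a ∈ A.space, ∃ b ∈ B.space, a + b = v :=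
        Submodule.mem_sup.1 (h.isCompl.sup_eq_top ▸ Submodule.mem_top)
      have h₁ := hx ⟨a, ha⟩
      rw [chart_apply] at h₁
      rw [map_add, h₁, B.2.2 _ (graphMap h hX x).2 _ hb, add_zero]
    have h₂ := add_graphMap_mem h hX x
    rw [hT, add_zero] at h₂
    exact Subtype.ext (Submodule.disjoint_def.1 hXA _ h₂ x.2)
  obtain ⟨W, hW, hWo, hWX⟩ := eventually_nhds_iff.1 (BSym.eventually_sign_eq _ hnd)
  filter_upwards [(isOpen_chart_preimage h hWo).mem_nhds ⟨hX, hWX⟩] with Y hY _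
  obtain ⟨hY', hYW⟩ := hY
  exact hW _ hYW

open Classical in
/-- The signature in the chart `φ_{A,B}`, with the value `0` outside its domain. -/
noncomputable def chartSign {A B : LagrangianGrassmannian ω} (h : A.Transverse B)
    (X : LagrangianGrassmannian ω) : ℤ :=
  if hX : X.Transverse B then (chart h X hX).sign else 0

theorem chartSign_of_transverse {A B X : LagrangianGrassmannian ω} (h : A.Transverse B)
    (hX : X.Transverse B) : chartSign h X = (chart h X hX).sign := dif_pos hX

theorem eventually_chartSign_sub_eq_of_transverse {A B B' X : LagrangianGrassmannian ω}
    (hB : A.Transverse B) (hB' : A.Transverse B') (h : B'.Transverse B)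
    (hX : X.Transverse B) (hX' : X.Transverse B') :
    ∀ᶠ Y in 𝓝 X, chartSign hB Y - chartSign hB' Y = chartSign hB X - chartSign hB' X := by
  filter_upwards [eventually_sign_chart_eq h hX hX',
    (isOpen_setOf_transverse hB).mem_nhds hX,
    (isOpen_setOf_transverse hB').mem_nhds hX'] with Y hY hYB hYB'
  rw [chartSign_of_transverse hB hX, chartSign_of_transverse hB' hX',
    chartSign_of_transverse hB hYB, chartSign_of_transverse hB' hYB',
    sign_chart_sub_sign_chart_right hB hB' h hYB hYB',
    sign_chart_sub_sign_chart_right hB hB' h hX hX', hY hYB]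

/-- For non-transverse `B`, `B'` compare both with a Lagrangian `C` transverse to all the others. -/
theorem eventually_chartSign_sub_eq {A B B' X : LagrangianGrassmannian ω}
    (hB : A.Transverse B) (hB' : A.Transverse B')
    (hX : X.Transverse B) (hX' : X.Transverse B') :
    ∀ᶠ Y in 𝓝 X, chartSign hB Y - chartSign hB' Y = chartSign hB X - chartSign hB' X := by
  obtain ⟨C, hC⟩ := exists_transverse ![A, B, B', X]
  have hAC : A.Transverse C := hC 0
  have hBC : B.Transverse C := hC 1
  have hBC' : B'.Transverse C := hC 2
  have hXC : X.Transverse C := hC 3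
  filter_upwards [eventually_chartSign_sub_eq_of_transverse hAC hB hBC hXC hX,
    eventually_chartSign_sub_eq_of_transverse hAC hB' hBC' hXC hX'] with Y h₁ h₂
  linarith

/-- The cocycle of the functions `sign φ_{A,B}` on the chart domains, for all `B` transverse to
`A`. Its increment is twice the `A`-Maslov index. -/
noncomputable def maslovCocycle (A : LagrangianGrassmannian ω) :
    IntCocycle {B : LagrangianGrassmannian ω // A.Transverse B} (LagrangianGrassmannian ω) where
  U B := {X | X.Transverse B.1}
  f B := chartSign B.2
  isOpen_U B := isOpen_setOf_transverse B.2
  exists_mem X := by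
    obtain ⟨C, hC⟩ := exists_transverse ![A, X]
    exact ⟨⟨C, hC 0⟩, hC 1⟩
  locally_const B B' _ hX := eventually_chartSign_sub_eq B.2 B'.2 hX.1 hX.2

theorem isMaslovIndex_increment (A : LagrangianGrassmannian ω) :
    A.IsMaslovIndex fun _ _ p => ((A.maslovCocycle.increment p : ℤ) : ℝ) / 2 where
  half_integer _ _ p := ⟨_, rfl⟩
  map_trans _ _ _ p q := by
    rw [IntCocycle.increment_trans]
    push_cast
    ring
  map_curve B hB X Y γ h := by
    have := A.maslovCocycle.increment_of_forall_mem γ ⟨B, hB⟩ h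
    rw [this]
    change (((chartSign hB (γ 1) - chartSign hB (γ 0) : ℤ) : ℝ)) / 2 = _
    rw [chartSign_of_transverse hB (h 1), chartSign_of_transverse hB (h 0)]
    push_cast
    ring

theorem isMaslovIndex_maslovIndex (A : LagrangianGrassmannian ω) :
    A.IsMaslovIndex A.maslovIndex :=
  Classical.epsilon_spec ⟨_, A.isMaslovIndex_increment⟩

/-! ### Paths in the Lagrangian Grassmannian -/

/-- A perturbation of the identity is invertible, with continuous inverse. -/
theorem exists_inverse_one_add_smul {E : Type*} [AddCommGroup E] [Module ℝ E]
    [FiniteDimensional ℝ E] (N : Module.End ℝ E) :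
    ∃ R : ℝ → Module.End ℝ E, R 0 = 1 ∧
      (∀ᶠ s in 𝓝 (0 : ℝ), R s * (1 + s • N) = 1 ∧ (1 + s • N) * R s = 1) ∧
      ∀ (ℓ : E →ₗ[ℝ] ℝ) (x : E), ContinuousAt (fun s => ℓ (R s x)) 0 := by
  let b := finBasis ℝ E
  let Φ := LinearMap.toMatrixAlgEquiv b
  let m : ℝ → Matrix (Fin (finrank ℝ E)) (Fin (finrank ℝ E)) ℝ := fun s => 1 + s • Φ N
  have hm : Continuous m := by fun_prop
  have hm0 : m 0 = 1 := by simp [m]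
  have hΦ : ∀ s, Φ (1 + s • N) = m s := fun s => by simp [m]
  have hdet : ∀ᶠ s in 𝓝 (0 : ℝ), (m s).det ≠ 0 := by
    refine hm.matrix_det.continuousAt.eventually_ne ?_
    simp [hm0]
  refine ⟨fun s => Φ.symm (m s)⁻¹, by simp [hm0], ?_, fun ℓ x => ?_⟩
  · filter_upwards [hdet] with s hs
    have hu : IsUnit (m s).det := isUnit_iff_ne_zero.2 hs
    constructor <;> apply Φ.injective
    · rw [map_mul, AlgEquiv.apply_symm_apply, hΦ, map_one, Matrix.nonsing_inv_mul _ hu]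
    · rw [map_mul, AlgEquiv.apply_symm_apply, hΦ, map_one, Matrix.mul_nonsing_inv _ hu]
  · let L : Matrix (Fin (finrank ℝ E)) (Fin (finrank ℝ E)) ℝ →ₗ[ℝ] ℝ :=
      ℓ ∘ₗ LinearMap.applyₗ x ∘ₗ Φ.symm.toLinearMap
    have hL : Continuous L := L.continuous_of_finiteDimensional
    have hinv : ContinuousAt (fun s => (m s)⁻¹) 0 := by
      have hi : (fun s => (m s)⁻¹) = fun s => ((m s).det)⁻¹ • (m s).adjugate := by
        ext1 s
        rw [Matrix.inv_def, Ring.inverse_eq_inv']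
      rw [hi]
      have h₀ : ContinuousAt (fun s => (m s).det) 0 := hm.matrix_det.continuousAt
      have h₁ : ContinuousAt (fun s => ((m s).det)⁻¹) 0 :=
        h₀.inv₀ (by rw [hm0, Matrix.det_one]; exact one_ne_zero)
      have h₂ : ContinuousAt (fun s => (m s).adjugate) 0 := hm.matrix_adjugate.continuousAt
      exact h₁.smul h₂
    have hLm : ContinuousAt (fun s => L (m s)⁻¹) 0 :=
      ContinuousAt.comp (f := fun s => (m s)⁻¹) hL.continuousAt hinv
    have hLe : ∀ A, L A = ℓ (Φ.symm A x) := fun A => by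
      simp only [L, LinearMap.comp_apply, LinearMap.applyₗ_apply_apply, AlgEquiv.toLinearMap_apply]
    simpa only [hLe] using hLm

variable {A B X : LagrangianGrassmannian ω}

/-- The parametrization `x ↦ x + t T x` of the graph of `t T`, where `X` is the graph of `T`. -/
noncomputable def scaledGraphMap (h : A.Transverse B) (hX : X.Transverse B) (t : ℝ) :
    A.space →ₗ[ℝ] V :=
  A.space.subtype + t • (B.space.subtype ∘ₗ graphMap h hX)

theorem scaledGraphMap_apply (h : A.Transverse B) (hX : X.Transverse B) (t : ℝ) (x : A.space) :
    scaledGraphMap h hX t x = x + t • (graphMap h hX x : V) := rfl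

theorem scaledGraphMap_injective (h : A.Transverse B) (hX : X.Transverse B) (t : ℝ) :
    Function.Injective (scaledGraphMap h hX t) := by
  rw [← LinearMap.ker_eq_bot, LinearMap.ker_eq_bot']
  intro x hx
  rw [scaledGraphMap_apply] at hx
  have hB : (x : V) ∈ B.space := by
    rw [eq_neg_of_add_eq_zero_left hx]
    exact B.space.neg_mem (B.space.smul_mem _ (Subtype.property _))
  exact Subtype.ext (Submodule.disjoint_def.1 h _ x.2 hB)

/-- The Lagrangian with coordinate `t φ_{A,B}(X)` in the chart `φ_{A,B}`. -/
noncomputable def scaledGraph (h : A.Transverse B) (hX : X.Transverse B) (t : ℝ) :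
    LagrangianGrassmannian ω :=
  ⟨LinearMap.range (scaledGraphMap h hX t), by
    rw [LinearMap.finrank_range_of_inj (scaledGraphMap_injective h hX t)]
    exact A.2.1, by
    rintro _ ⟨x, rfl⟩ _ ⟨y, rfl⟩
    have h₁ := (chart h X hX).2.eq x y
    rw [chart_apply, chart_apply, ω.antisymm (graphMap h hX y : V)] at h₁
    have h₂ := A.2.2 _ x.2 _ y.2
    have h₃ := B.2.2 _ (graphMap h hX x).2 _ (graphMap h hX y).2
    simp only [scaledGraphMap_apply, map_add, map_smul, LinearMap.add_apply,
      LinearMap.smul_apply, smul_eq_mul, h₁, h₂, h₃]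
    ring⟩

theorem scaledGraphMap_mem (h : A.Transverse B) (hX : X.Transverse B) (t : ℝ) (x : A.space) :
    scaledGraphMap h hX t x ∈ (scaledGraph h hX t).space := ⟨x, rfl⟩

theorem scaledGraph_zero (h : A.Transverse B) (hX : X.Transverse B) :
    scaledGraph h hX 0 = A := by
  refine Subtype.ext (Submodule.ext fun v => ?_)
  constructor
  · rintro ⟨x, rfl⟩
    rw [scaledGraphMap_apply, zero_smul, add_zero]
    exact x.2
  · intro hv
    exact ⟨⟨v, hv⟩, by rw [scaledGraphMap_apply, zero_smul, add_zero]⟩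

theorem scaledGraph_one (h : A.Transverse B) (hX : X.Transverse B) :
    scaledGraph h hX 1 = X := by
  refine Subtype.ext (Submodule.ext fun v => ?_)
  refine Iff.trans ?_ (isGraphOf_graphMap h hX v).symm
  constructor
  · rintro ⟨x, rfl⟩
    exact ⟨x, by rw [scaledGraphMap_apply, one_smul]⟩
  · rintro ⟨x, rfl⟩
    exact ⟨x, by rw [scaledGraphMap_apply, one_smul]⟩

/-- The curve is continuous in every chart `φ_{C,D}`, not only in `φ_{A,B}`: near a parameter `t₀`
the projection to `C` along `D` of the parametrization of the curve at `t` is its projection at `t₀`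
times `1 + (t - t₀) N`, and can be inverted. -/
theorem continuous_scaledGraph (h : A.Transverse B) (hX : X.Transverse B) :
    Continuous (scaledGraph h hX) := by
  refine continuous_generateFrom_iff.2 ?_
  rintro _ ⟨C, D, hCD, W, hW, rfl⟩
  refine isOpen_iff_mem_nhds.2 fun t₀ ⟨h₀, hW₀⟩ => ?_
  let P := C.space.projectionOnto D.space hCD.isCompl
  let P' := D.space.projectionOnto C.space hCD.isCompl.symm
  have hPP : ∀ v : V, (P v : V) + (P' v : V) = v := fun v => by
    rw [Submodule.coe_projectionOnto_apply, Submodule.coe_projectionOnto_apply]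
    exact Submodule.projection_add_projection_eq_self hCD.isCompl v
  have hdim : finrank ℝ A.space = finrank ℝ C.space := by
    have h₁ : 2 * finrank ℝ A.space = finrank ℝ V := A.2.1
    have h₂ : 2 * finrank ℝ C.space = finrank ℝ V := C.2.1
    omega
  have hinj : Function.Injective (P ∘ₗ scaledGraphMap h hX t₀) := by
    rw [← LinearMap.ker_eq_bot, LinearMap.ker_eq_bot']
    intro x hx
    have hD : scaledGraphMap h hX t₀ x ∈ D.space :=
      (Submodule.projectionOnto_apply_eq_zero_iff hCD.isCompl).1 hx
    have := Submodule.disjoint_def.1 h₀ _ (scaledGraphMap_mem h hX t₀ x) hD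
    exact scaledGraphMap_injective h hX t₀ (this.trans (map_zero _).symm)
  let M := LinearMap.linearEquivOfInjective _ hinj hdim
  have hM : ∀ x, P (scaledGraphMap h hX t₀ x) = M x := fun x => rfl
  let G : A.space →ₗ[ℝ] V := B.space.subtype ∘ₗ graphMap h hX
  let N : Module.End ℝ A.space := M.symm.toLinearMap ∘ₗ P ∘ₗ G
  have hFs : ∀ s x, scaledGraphMap h hX (t₀ + s) x = scaledGraphMap h hX t₀ x + s • G x := by
    intro s x
    simp only [scaledGraphMap_apply, add_smul, add_assoc]
    rfl
  have hPF : ∀ s x, P (scaledGraphMap h hX (t₀ + s) x) = M ((1 + s • N) x) := by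
    intro s x
    rw [hFs, map_add, map_smul, hM]
    simp [N]
  obtain ⟨R, hR0, hR, hRc⟩ := exists_inverse_one_add_smul N
  have htr : ∀ s, R s * (1 + s • N) = 1 → (scaledGraph h hX (t₀ + s)).Transverse D := by
    intro s hs
    refine Submodule.disjoint_def.2 ?_
    rintro _ ⟨x, rfl⟩ hxD
    have h₁ : P (scaledGraphMap h hX (t₀ + s) x) = 0 :=
      (Submodule.projectionOnto_apply_eq_zero_iff hCD.isCompl).2 hxD
    rw [hPF, LinearEquiv.map_eq_zero_iff] at h₁
    have h₂ : x = 0 := by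
      have := congrArg (fun f : Module.End ℝ A.space => f x) hs
      simpa [h₁] using this.symm
    rw [h₂, map_zero]
  have hgr : ∀ s (hs : (scaledGraph h hX (t₀ + s)).Transverse D), (1 + s • N) * R s = 1 →
      ∀ x, graphMap hCD hs x = P' (scaledGraphMap h hX (t₀ + s) (R s (M.symm x))) := by
    intro s hs hRs x
    refine graphMap_eq_of_add_mem hCD hs ?_
    have h₁ : P (scaledGraphMap h hX (t₀ + s) (R s (M.symm x))) = x := by
      rw [hPF]
      have := congrArg (fun f : Module.End ℝ A.space => f (M.symm x)) hRs
      rw [show (1 + s • N) (R s (M.symm x)) = M.symm x from this, LinearEquiv.apply_symm_apply]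
    have h₂ := hPP (scaledGraphMap h hX (t₀ + s) (R s (M.symm x)))
    rw [h₁] at h₂
    rw [h₂]
    exact scaledGraphMap_mem h hX _ _
  -- `φ s` is the coordinate of the curve at `t₀ + s` in the chart, for small `s`.
  let φ : ℝ → C.space × C.space → ℝ := fun s p =>
    ω.form (P' (scaledGraphMap h hX (t₀ + s) (R s (M.symm p.1))) : V) (p.2 : V)
  have hφ : ContinuousAt φ 0 := by
    refine continuousAt_pi.2 fun p => ?_
    let ℓ (F : A.space →ₗ[ℝ] V) : A.space →ₗ[ℝ] ℝ :=
      (ω.form.flip (p.2 : V)) ∘ₗ D.space.subtype ∘ₗ P' ∘ₗ F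
    have : (fun s => φ s p) = fun s => ℓ (scaledGraphMap h hX t₀) (R s (M.symm p.1)) +
        s * ℓ G (R s (M.symm p.1)) := by
      ext s
      simp only [φ, ℓ, hFs]
      simp
    rw [this]
    exact (hRc _ _).add (continuousAt_id.mul (hRc _ _))
  obtain ⟨W', hW', rfl⟩ := isOpen_induced_iff.1 hW
  have hφ0 : φ 0 ∈ W' := by
    obtain ⟨hs, hsW⟩ : ∃ hL : (scaledGraph h hX (t₀ + 0)).Transverse D, chart hCD _ hL ∈
        (fun (B : BSym C.space) (p : C.space × C.space) => B.1 p.1 p.2) ⁻¹' W' := by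
      rw [add_zero]
      exact ⟨h₀, hW₀⟩
    have : φ 0 = fun p => (chart hCD _ hs).1 p.1 p.2 := by
      ext p
      simp only [φ]
      rw [← hgr 0 hs (by simp [hR0]) p.1, chart_apply]
    rw [this]
    exact hsW
  have hev : ∀ᶠ s in 𝓝 (0 : ℝ), scaledGraph h hX (t₀ + s) ∈
      {L | ∃ hL : L.Transverse D, chart hCD L hL ∈
        (fun (B : BSym C.space) (p : C.space × C.space) => B.1 p.1 p.2) ⁻¹' W'} := by
    filter_upwards [hR, hφ.eventually (hW'.mem_nhds hφ0)] with s hs hs'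
    refine ⟨htr s hs.1, ?_⟩
    have : φ s = fun p => (chart hCD _ (htr s hs.1)).1 p.1 p.2 := by
      ext p
      simp only [φ]
      rw [← hgr s (htr s hs.1) hs.2 p.1, chart_apply]
    rw [this] at hs'
    exact hs'
  have ht : Filter.Tendsto (fun t => t - t₀) (𝓝 t₀) (𝓝 0) := by
    have : ContinuousAt (fun t => t - t₀) t₀ := by fun_prop
    simpa [ContinuousAt] using this
  filter_upwards [ht.eventually hev] with t htt
  rwa [add_sub_cancel] at htt

/-- The Lagrangian Grassmannian is path connected. -/
theorem nonempty_path (A X : LagrangianGrassmannian ω) : Nonempty (Path A X) := by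
  obtain ⟨B, hB⟩ := exists_transverse ![A, X]
  exact ⟨{
    toFun := fun t => scaledGraph (hB 0) (hB 1) t
    continuous_toFun := (continuous_scaledGraph (hB 0) (hB 1)).comp continuous_subtype_val
    source' := scaledGraph_zero (hB 0) (hB 1)
    target' := scaledGraph_one (hB 0) (hB 1) }⟩

/-! ### The Hörmander index -/

/-- For transverse `A`, `A'` the difference of the two Maslov indices has the Kashiwara index
as a global potential: by the cocycle identity this holds in each chart domain. -/
theorem maslovIndex_sub_maslovIndex {A A' : LagrangianGrassmannian ω} (h : A.Transverse A')
    {X Y : LagrangianGrassmannian ω} (γ : Path X Y) :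
    A'.maslovIndex X Y (Path.Homotopic.Quotient.mk γ) -
      A.maslovIndex X Y (Path.Homotopic.Quotient.mk γ) =
        1 / 2 * (kashiwara h Y : ℝ) - 1 / 2 * (kashiwara h X : ℝ) := by
  refine eq_sub_of_locally_eq_sub
    (fun X Y p => A'.maslovIndex X Y p - A.maslovIndex X Y p)
    (fun X => 1 / 2 * (kashiwara h X : ℝ)) (fun X Y Z p q => ?_) (fun X => ?_) γ
  · rw [A.isMaslovIndex_maslovIndex.map_trans, A'.isMaslovIndex_maslovIndex.map_trans]
    ring
  · obtain ⟨B, hB⟩ := exists_transverse ![A, A', X]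
    have hAB : A.Transverse B := hB 0
    have hA' : A'.Transverse B := hB 1
    refine ⟨_, (isOpen_setOf_transverse hAB).mem_nhds (hB 2 : X.Transverse B), ?_⟩
    intro Y Z γ hγ
    have key : ∀ t, ((chart hAB (γ t) (hγ t)).sign : ℝ) - (chart hA' (γ t) (hγ t)).sign =
        (chart hAB A' hA').sign - kashiwara h (γ t) := fun t => by
      exact_mod_cast sign_chart_sub_sign_chart h hAB hA' (hγ t)
    have h0 := key 0
    have h1 := key 1
    rw [A.isMaslovIndex_maslovIndex.map_curve B hAB Y Z γ hγ,
      A'.isMaslovIndex_maslovIndex.map_curve B hA' Y Z γ hγ]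
    simp only [γ.source, γ.target] at h0 h1 ⊢
    linarith

end LagrangianGrassmannian

theorem proposition3p2 {V : Type*} [AddCommGroup V] [Module ℝ V] [FiniteDimensional ℝ V]
    (ω : SymplecticForm V) (L L' L₀ L₁ : LagrangianGrassmannian ω)
    (hL : L.Transverse L₀) (hL' : L'.Transverse L₀) (hL₁ : L₁.Transverse L₀) :
    LagrangianGrassmannian.hormanderIndex L₀ L L₀ L' =
      1 / 2 * (BSym.sign (LagrangianGrassmannian.chart hL₁ L' hL' -
        LagrangianGrassmannian.chart hL₁ L hL) : ℝ) := by
  have hex : LagrangianGrassmannian.IsHormanderIndex L₀ L L₀ L'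
      (1 / 2 * (LagrangianGrassmannian.kashiwara hL.symm L' : ℝ)) := by
    refine ⟨LagrangianGrassmannian.nonempty_path L₀ L', fun γ => ?_⟩
    rw [LagrangianGrassmannian.maslovIndex_sub_maslovIndex hL.symm γ,
      LagrangianGrassmannian.kashiwara_self hL.symm]
    simp
  obtain ⟨⟨γ⟩, -⟩ := id hex
  have hspec : LagrangianGrassmannian.IsHormanderIndex L₀ L L₀ L'
      (LagrangianGrassmannian.hormanderIndex L₀ L L₀ L') :=
    Classical.epsilon_spec ⟨_, hex⟩
  rw [← hspec.2 γ, hex.2 γ, LagrangianGrassmannian.sign_chart_sub_chart hL₁ hL hL',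
    LagrangianGrassmannian.kashiwara_eq_sign_chart hL.symm hL']
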